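/- All rings and algebras are commutative with identity. An $R$-algebra $A$ is of rank $n$ if, as an $R$-module, it is finitely generated, projective and locally free of constant rank $n$. For $a\in A$ let $P_a(X)\in R[X]$ be the characteristic polynomial of multiplication by $a$ on $A$ (the determinant of $X-a$ acting on the finitely generated projective $R[X]$-module $A\otimes_R R[X]$); likewise, for an $R$-algebra $R'$ and $a\in A\otimes_R R'$, let $P_a\in R'[X]$ be the characteristic polynomial of $a$ in the $R'$-algebra $A\otimes_R R'$. Let $S$ be a finite set. Say that a family $(\beta_s\colon A\to B)_{s\in S}$ of $R$-algebra maps to an $R$-algebra $B$ has property $(*)$ if for every $R$-algebra $R'$ and every $a\in A\otimes_R R'$ the polynomial $\prod_{s\in S}\bigl(X-(\beta_s\otimes\mathrm{Id})(a)\bigr)$ divides the image of $P_a$ in $(B\otimes_R R')[X]$. An $S$-closure of $A$ is an $R$-algebra $A^{(S)}$ with a family of $R$-algebra maps $(\alpha_s\colon A\to A^{(S)})_{s\in S}$ that has $(*)$ and is universal with this property: for every family $(\beta_s\colon A\to B)_{s\in S}$ with $(*)$ there is a unique $R$-algebra map $\varphi\colon A^{(S)}\to B$ with $\varphi\circ\alpha_s=\beta_s$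 for all $s\in S$. Proposition. Let $R$ be a nonzero ring, let $A$ be an $R$-algebra of rank $n>0$, and let $S$ be a finite set with $\#S\le n$. Then the $S$-closure $A^{(S)}$ of $A$ (exists and) is not the zero ring. -/

import Mathlib

open scoped TensorProduct Polynomial

universe u v w

section Determinant

variable {R : Type u} [CommRing R] {M : Type v} [AddCommGroup M] [Module R M]

/-- If `M` is a direct summand of a finite free module `F`, through `p : F → M` and `i : M → F`
with `p ∘ i = id`, then `1 + i ∘ (g - 1) ∘ p` is the endomorphism of `F = i(M) ⊕ ker p` that is
`g` on `M` and the identity on the complement. Its determinant does not depend on `F`, `p`, `i`. -/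
theorem det_one_add_summand_eq {F : Type*} {F' : Type*}
    [AddCommGroup F] [Module R F] [Module.Finite R F] [Module.Free R F]
    [AddCommGroup F'] [Module R F'] [Module.Finite R F'] [Module.Free R F']
    (p : F →ₗ[R] M) (i : M →ₗ[R] F) (h : p ∘ₗ i = LinearMap.id)
    (p' : F' →ₗ[R] M) (i' : M →ₗ[R] F') (h' : p' ∘ₗ i' = LinearMap.id)
    (g : M →ₗ[R] M) :
    LinearMap.det (LinearMap.id + i ∘ₗ (g - LinearMap.id) ∘ₗ p) =
      LinearMap.det (LinearMap.id + i' ∘ₗ (g - LinearMap.id) ∘ₗ p') := by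
  classical
  have key : ∀ (f : F →ₗ[R] F') (k : F' →ₗ[R] F),
      LinearMap.det (LinearMap.id + k ∘ₗ f) = LinearMap.det (LinearMap.id + f ∘ₗ k) := by
    intro f k
    let b := Module.Free.chooseBasis R F
    let b' := Module.Free.chooseBasis R F'
    rw [← LinearMap.det_toMatrix b, ← LinearMap.det_toMatrix b', map_add, map_add,
      LinearMap.toMatrix_comp b b' b, LinearMap.toMatrix_comp b' b b',
      LinearMap.toMatrix_id, LinearMap.toMatrix_id, Matrix.det_one_add_mul_comm]
  have e1 : i ∘ₗ (g - LinearMap.id) ∘ₗ p =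
      (i ∘ₗ (g - LinearMap.id) ∘ₗ p') ∘ₗ (i' ∘ₗ p) := by
    ext x
    have := LinearMap.congr_fun h' (p x)
    simp only [LinearMap.comp_apply, LinearMap.id_apply] at this ⊢
    rw [this]
  have e2 : i' ∘ₗ (g - LinearMap.id) ∘ₗ p' =
      (i' ∘ₗ p) ∘ₗ (i ∘ₗ (g - LinearMap.id) ∘ₗ p') := by
    ext x
    have := LinearMap.congr_fun h ((g - (LinearMap.id : M →ₗ[R] M)) (p' x))
    simp only [LinearMap.comp_apply, LinearMap.id_apply] at this ⊢
    rw [this]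
  rw [e1, e2]
  exact key _ _

variable [Module.Finite R M] [Module.Projective R M]

/-- The determinant of an endomorphism `g` of a finitely generated projective module `M`:
the determinant of `g ⊕ id` on a finite free module `M ⊕ N`. (`LinearMap.det` has a junk value
if `M` is not free.) -/
noncomputable def projDet (g : M →ₗ[R] M) : R :=
  let ex := Module.Finite.exists_comp_eq_id_of_projective R M
  let p := ex.choose_spec.choose
  let i := ex.choose_spec.choose_spec.choose
  LinearMap.det (LinearMap.id + i ∘ₗ (g - LinearMap.id) ∘ₗ p)

/-- `projDet` can be computed from any presentation of `M` as a summand of a finite free module. -/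
theorem projDet_eq {F : Type*} [AddCommGroup F] [Module R F] [Module.Finite R F] [Module.Free R F]
    (p : F →ₗ[R] M) (i : M →ₗ[R] F) (h : p ∘ₗ i = LinearMap.id) (g : M →ₗ[R] M) :
    projDet g = LinearMap.det (LinearMap.id + i ∘ₗ (g - LinearMap.id) ∘ₗ p) :=
  det_one_add_summand_eq _ _
    (Module.Finite.exists_comp_eq_id_of_projective R M).choose_spec.choose_spec.choose_spec.2.2
    p i h g

/-- On finite free modules `projDet` is the usual determinant. -/
theorem projDet_eq_det [Module.Free R M] (g : M →ₗ[R] M) : projDet g = LinearMap.det g := by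
  rw [projDet_eq LinearMap.id LinearMap.id rfl]
  simp

/-- The characteristic polynomial of an endomorphism `f` of a finitely generated projective
module `M`: the determinant of `X - f` on `R[X] ⊗ M`. -/
noncomputable def projCharpoly (f : M →ₗ[R] M) : R[X] :=
  projDet ((Polynomial.X : R[X]) • LinearMap.id - f.baseChange R[X])

/-- On finite free modules `projCharpoly` is the usual characteristic polynomial. -/
theorem projCharpoly_eq_charpoly [Module.Free R M] (f : M →ₗ[R] M) :
    projCharpoly f = f.charpoly := by
  classical
  let b := Module.Free.chooseBasis R M
  have e : LinearMap.toMatrix (b.baseChange R[X]) (b.baseChange R[X])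
      ((Polynomial.X : R[X]) • LinearMap.id - f.baseChange R[X]) =
      (LinearMap.toMatrix b b f).charmatrix := by
    ext1 i j
    simp [LinearMap.toMatrix_apply, Matrix.charmatrix, Matrix.diagonal_apply,
      Finsupp.single_apply, eq_comm, Algebra.smul_def]
  rw [projCharpoly, projDet_eq_det, ← LinearMap.det_toMatrix (b.baseChange R[X]), e,
    ← f.charpoly_toMatrix b, Matrix.charpoly]

end Determinant

/-- The characteristic polynomial `P_a` of an element `a` of a finite projective `R`-algebra `A`,
that is, of multiplication by `a`. -/
noncomputable def elemCharpoly (R : Type u) [CommRing R] {A : Type v} [CommRing A] [Algebra R A]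
    [Module.Finite R A] [Module.Projective R A] (a : A) : R[X] :=
  projCharpoly (LinearMap.mulLeft R a)

section Closure

variable (R : Type u) [CommRing R] {A : Type v} [CommRing A] [Algebra R A]
  [Module.Finite R A] [Module.Projective R A] {S : Type w} [Fintype S]

/-- The divisibility property of a family of `R`-algebra maps `β s : A → B`: for every
`R`-algebra `R'` and every `a` in `A' = R' ⊗ A`, the polynomial `∏ s, (X - (id ⊗ β s) a)` divides
the characteristic polynomial of `a` (over `R'`) in `(R' ⊗ B)[X]`. -/
def CharpolyDivisible {B : Type (max u v w)} [CommRing B] [Algebra R B]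
    (β : S → A →ₐ[R] B) : Prop :=
  ∀ (R' : Type (max u v w)) [CommRing R'] [Algebra R R'] (a : R' ⊗[R] A),
    (∏ s : S, (Polynomial.X -
        Polynomial.C (Algebra.TensorProduct.map (AlgHom.id R' R') (β s) a))) ∣
      (elemCharpoly R' a).map (algebraMap R' (R' ⊗[R] B))

/-- `(C, α)` is an `S`-closure of the `R`-algebra `A`: it is universal among the `R`-algebras
with a family of maps from `A`, indexed by `S`, that has the divisibility property. -/
structure IsSClosure (C : Type (max u v w)) [CommRing C] [Algebra R C]
    (α : S → A →ₐ[R] C) : Prop where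
  divisible : CharpolyDivisible R α
  universal : ∀ (B : Type (max u v w)) [CommRing B] [Algebra R B] (β : S → A →ₐ[R] B),
    CharpolyDivisible R β → ∃! φ : C →ₐ[R] B, ∀ s, φ.comp (α s) = β s

end Closure

/-!
Existence. A monic polynomial divides another one if and only if the remainder of the division
vanishes. Choose generators `g i` of the module `A`; every element of every base change of `A` is a
specialization of the generic element `∑ i, X i ⊗ g i` over the polynomial ring `P = R[X i]`, and
characteristic polynomials commute with base change (`elemCharpoly_map`). So a family
`β s : A → B` has the divisibility property if and only if it has it for the generic element
(`charpolyDivisible_iff_genericElem`). Let `T` be the tensor power of `A` indexed by `S`, the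
universal algebra with a family of maps from `A`. As `P` is a free `R`-module, the vanishing of the
remainder in `P ⊗ B` means that the map `T → B` given by the family kills a certain ideal `I` of
`T`, generated by the coordinates of the coefficients of the remainder in `P ⊗ T`
(`coordIdeal_le_ker_iff`). Hence `T ⧸ I` is the closure (`exists_isSClosure`).

Nontriviality. By the universal property it is enough to find a family with the divisibility
property and values in a field `k`. Take `k` to be an algebraic closure of a residue field of `R`.
The algebra `k ⊗ A` has dimension `n`, and a full flag of ideals in it yields `n` characters `χ j`
with values in `k` such that multiplication by `a` is triangular with diagonal entries `χ j a`
(`exists_basis_smul_sub_mem_span`). The flag survives every extension of scalars, so the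
characteristic polynomial of every element `a` of every base change is the product of the
`X - χ j a` (`exists_elemCharpoly_eq_prod`), and any `#S ≤ n` of its factors divide it.
-/

/-! ### Characteristic polynomials of endomorphisms of projective modules -/

section Charpoly

variable {R : Type*} [CommRing R] {M : Type*} [AddCommGroup M] [Module R M]
  [Module.Finite R M] [Module.Projective R M]

/-- The characteristic polynomial as the determinant of a polynomial matrix: on `i(M) ⊕ ker p = F`,
the endomorphism `X - f` of `M`, extended by the identity, is `1 + (X - 1) i p - i f p`. Since base
change acts entrywise on the matrices of `i p` and `i f p`, this formula reduces base change of
characteristic polynomials to base change of determinants. -/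
theorem projCharpoly_eq_det_of_summand {F ι : Type*} [AddCommGroup F] [Module R F] [Fintype ι]
    [DecidableEq ι] (b : Module.Basis ι R F) (p : F →ₗ[R] M) (i : M →ₗ[R] F)
    (h : p ∘ₗ i = LinearMap.id) (f : M →ₗ[R] M) :
    projCharpoly f = (1 + ((Polynomial.X - 1 : R[X]) •
        (LinearMap.toMatrix b b (i ∘ₗ p)).map Polynomial.C -
      (LinearMap.toMatrix b b (i ∘ₗ f ∘ₗ p)).map Polynomial.C)).det := by
  have := Module.Finite.of_basis b
  have := Module.Free.of_basis b
  have hb : p.baseChange R[X] ∘ₗ i.baseChange R[X] = LinearMap.id := by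
    rw [← LinearMap.baseChange_comp, h, LinearMap.baseChange_id]
  have e : i.baseChange R[X] ∘ₗ ((Polynomial.X : R[X]) • LinearMap.id - f.baseChange R[X] -
        LinearMap.id) ∘ₗ p.baseChange R[X] + (i ∘ₗ f ∘ₗ p).baseChange R[X] =
      (Polynomial.X - 1 : R[X]) • (i ∘ₗ p).baseChange R[X] := by
    ext x
    simp [LinearMap.baseChange_comp, sub_smul, sub_right_comm]
  let c := Algebra.TensorProduct.basis R[X] b
  have e' := congrArg (LinearMap.toMatrix c c) e
  rw [map_add, map_smul, LinearMap.toMatrix_baseChange, LinearMap.toMatrix_baseChange] at e'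
  rw [projCharpoly, projDet_eq _ _ hb, ← LinearMap.det_toMatrix c, map_add, LinearMap.toMatrix_id,
    eq_sub_of_add_eq e']
  rfl

theorem projCharpoly_baseChange (R' : Type*) [CommRing R'] [Algebra R R'] (f : M →ₗ[R] M) :
    projCharpoly (f.baseChange R') = (projCharpoly f).map (algebraMap R R') := by
  classical
  obtain ⟨n, p, i, -, -, h⟩ := Module.Finite.exists_comp_eq_id_of_projective R M
  have hb : p.baseChange R' ∘ₗ i.baseChange R' = LinearMap.id := by
    rw [← LinearMap.baseChange_comp, h, LinearMap.baseChange_id]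
  rw [projCharpoly_eq_det_of_summand (Pi.basisFun R (Fin n)) p i h,
    projCharpoly_eq_det_of_summand
      (Algebra.TensorProduct.basis R' (Pi.basisFun R (Fin n))) _ _ hb,
    ← LinearMap.baseChange_comp, ← LinearMap.baseChange_comp, ← LinearMap.baseChange_comp,
    LinearMap.toMatrix_baseChange, LinearMap.toMatrix_baseChange,
    ← Polynomial.coe_mapRingHom, RingHom.map_det]
  congr 1
  ext1 j k
  simp [Matrix.one_apply, apply_ite (Polynomial.map (algebraMap R R'))]

theorem projCharpoly_conj {N : Type*} [AddCommGroup N] [Module R N] [Module.Finite R N]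
    [Module.Projective R N] (e : M ≃ₗ[R] N) (f : M →ₗ[R] M) (g : N →ₗ[R] N)
    (h : ∀ x, g (e x) = e (f x)) : projCharpoly g = projCharpoly f := by
  classical
  obtain ⟨n, p, i, -, -, hpi⟩ := Module.Finite.exists_comp_eq_id_of_projective R M
  have he : (e.toLinearMap ∘ₗ p) ∘ₗ (i ∘ₗ e.symm.toLinearMap) = LinearMap.id := by
    ext x
    have := LinearMap.congr_fun hpi (e.symm x)
    simp only [LinearMap.comp_apply, LinearMap.id_apply] at this
    simp [this]
  rw [projCharpoly_eq_det_of_summand (Pi.basisFun R (Fin n)) p i hpi,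
    projCharpoly_eq_det_of_summand (Pi.basisFun R (Fin n)) _ _ he]
  have e1 : (i ∘ₗ e.symm.toLinearMap) ∘ₗ (e.toLinearMap ∘ₗ p) = i ∘ₗ p := by
    ext; simp
  have e2 : (i ∘ₗ e.symm.toLinearMap) ∘ₗ g ∘ₗ (e.toLinearMap ∘ₗ p) = i ∘ₗ f ∘ₗ p := by
    ext; simp [h]
  rw [e1, e2]

variable {A : Type*} [CommRing A] [Algebra R A] [Module.Finite R A] [Module.Projective R A]

theorem elemCharpoly_algEquiv {B : Type*} [CommRing B] [Algebra R B] [Module.Finite R B]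
    [Module.Projective R B] (e : A ≃ₐ[R] B) (a : A) :
    elemCharpoly R (e a) = elemCharpoly R a :=
  projCharpoly_conj e.toLinearEquiv _ _ fun x => by simp

theorem elemCharpoly_one_tmul (R' : Type*) [CommRing R'] [Algebra R R'] (a : A) :
    elemCharpoly R' ((1 : R') ⊗ₜ[R] a) = (elemCharpoly R a).map (algebraMap R R') := by
  rw [elemCharpoly, elemCharpoly, ← projCharpoly_baseChange]
  congr 1
  ext x
  simp

theorem elemCharpoly_map {R' R'' : Type*} [CommRing R'] [CommRing R''] [Algebra R R']
    [Algebra R R''] [Algebra R' R''] [IsScalarTower R R' R''] (a : R' ⊗[R] A) :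
    elemCharpoly R'' (Algebra.TensorProduct.map (Algebra.ofId R' R'') (AlgHom.id R A) a) =
      (elemCharpoly R' a).map (algebraMap R' R'') := by
  rw [← elemCharpoly_one_tmul,
    ← elemCharpoly_algEquiv (Algebra.TensorProduct.cancelBaseChange R R' R'' R'' A)]
  congr 1
  induction a using TensorProduct.induction_on with
  | zero => simp
  | add x y hx hy => simp only [map_add, TensorProduct.tmul_add, hx, hy]
  | tmul r a => simp [Algebra.ofId_apply, Algebra.smul_def]

end Charpoly

/-! ### Finite algebras over an algebraically closed field -/

section Flag

variable {k : Type*} [Field k] [IsAlgClosed k] {T : Type*} [CommRing T] [Algebra k T]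
  [Module.Finite k T]

/-- Nullstellensatz for a finite algebra over an algebraically closed field: every residue field
is the base field, so a maximal ideal is the kernel of a character `χ`. -/
theorem exists_algHom_sub_mem (I : Ideal T) [I.IsMaximal] :
    ∃ χ : T →ₐ[k] k, ∀ a, a - algebraMap k T (χ a) ∈ I := by
  let := Ideal.Quotient.field I
  let e : k ≃ₐ[k] T ⧸ I := AlgEquiv.ofBijective (Algebra.ofId k (T ⧸ I))
    IsAlgClosed.algebraMap_bijective_of_isIntegral
  refine ⟨e.symm.toAlgHom.comp (Ideal.Quotient.mkₐ k I), fun a => ?_⟩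
  rw [← Ideal.Quotient.eq]
  exact (e.apply_symm_apply (Ideal.Quotient.mk I a)).symm

/-- A finite-dimensional `T`-module has a full flag of `T`-submodules. It is encoded by a basis `b`,
the members of the flag being the spans of the `b i` with `i ≥ j`, together with the characters
by which `T` acts on the one-dimensional successive quotients. -/
theorem exists_basis_smul_sub_mem_span : ∀ (n : ℕ) (M : Type*) [AddCommGroup M] [Module k M]
    [Module T M] [IsScalarTower k T M] [Module.Finite k M] (_ : Module.finrank k M = n),
    ∃ (b : Module.Basis (Fin n) k M) (χ : Fin n → T →ₐ[k] k), ∀ (a : T) (j : Fin n),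
      a • b j - χ j a • b j ∈ Submodule.span k (b '' Set.Ioi j) := by
  intro n
  induction n using Nat.strong_induction_on with
  | _ n ih =>
  intro M _ _ _ _ _ hM
  obtain rfl | hn := Nat.eq_zero_or_pos n
  · exact ⟨Module.finBasisOfFinrankEq k M hM, finZeroElim, fun _ j => j.elim0⟩
  have : Nontrivial M := Module.nontrivial_of_finrank_pos (R := k) (hM ▸ hn)
  have : Module.Finite T M := Module.Finite.of_restrictScalars_finite k T M
  -- a maximal submodule `N` has codimension one, since `T` acts on `M ⧸ N` through a character
  obtain ⟨N, hN, -⟩ := (eq_top_or_exists_le_coatom (⊥ : Submodule T M)).resolve_left bot_ne_top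
  have hs : IsSimpleModule T (M ⧸ N) := isSimpleModule_iff_isCoatom.2 hN
  have := IsSimpleModule.annihilator_isMaximal (R := T) (M := M ⧸ N)
  obtain ⟨χ, hχ⟩ := exists_algHom_sub_mem (k := k) (Module.annihilator T (M ⧸ N))
  have hχN : ∀ (a : T) (x : M), a • x - χ a • x ∈ N := fun a x => by
    have := Module.mem_annihilator.1 (hχ a) (N.mkQ x)
    rwa [← map_smul, Submodule.mkQ_apply, Submodule.Quotient.mk_eq_zero, sub_smul,
      algebraMap_smul] at this
  obtain ⟨y, hy⟩ : ∃ y, y ∉ N := by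
    by_contra! h
    exact hN.1 (eq_top_iff.2 fun x _ => h x)
  let N' : Submodule k M := N.restrictScalars k
  have hlt : Module.finrank k N' < n := hM ▸ Submodule.finrank_lt (fun h => hy
    (show y ∈ N' from h ▸ Submodule.mem_top))
  let _ : Module T N' := inferInstanceAs (Module T N)
  have : IsScalarTower k T N' := ⟨fun c a x => Subtype.ext (smul_assoc c a (x : M))⟩
  obtain ⟨b, ψ, hb⟩ := ih _ hlt N' rfl
  let b' : Module.Basis (Fin (Module.finrank k N' + 1)) k M := Module.Basis.mkFinCons (N := N') y b
    (fun c x hx h => by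
      by_contra hc
      refine hy ((N'.smul_mem_iff hc).1 ?_)
      rw [eq_neg_of_add_eq_zero_left h]
      exact N'.neg_mem hx)
    (fun z => by
      have : z ∈ N ⊔ Submodule.span T {y} := by
        rw [hN.2 (N ⊔ Submodule.span T {y}) (by simpa using hy)]
        trivial
      obtain ⟨x, hx, w, hw, rfl⟩ := Submodule.mem_sup.1 this
      obtain ⟨a, rfl⟩ := Submodule.mem_span_singleton.1 hw
      refine ⟨-χ a, ?_⟩
      rw [neg_smul, ← sub_eq_add_neg, add_sub_assoc]
      exact N.add_mem hx (hχN a y))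
  have hn' : Module.finrank k N' + 1 = n := by
    rw [← hM, Module.finrank_eq_card_basis b', Fintype.card_fin]
  have hcoe : ⇑b' = Fin.cons y ((↑) ∘ b) := Module.Basis.coe_mkFinCons _ _ _ _
  clear_value b'
  subst hn'
  refine ⟨b', Fin.cons χ ψ, fun a j => ?_⟩
  rw [hcoe]
  refine Fin.cases ?_ (fun j => ?_) j
  · have h := Submodule.mem_map_of_mem (f := N'.subtype)
      (show (⟨_, hχN a y⟩ : N') ∈ Submodule.span k (Set.range b) from b.span_eq ▸ trivial)
    rw [Submodule.map_span, ← Set.range_comp] at h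
    refine Submodule.span_mono ?_ h
    rintro _ ⟨i, rfl⟩
    exact ⟨i.succ, i.succ_pos, rfl⟩
  · have h := Submodule.mem_map_of_mem (f := N'.subtype) (hb a j)
    rw [Submodule.map_span, ← Set.image_comp] at h
    refine Submodule.span_mono ?_ h
    rintro _ ⟨i, hi, rfl⟩
    exact ⟨i.succ, Fin.succ_lt_succ_iff.2 hi, rfl⟩

/-- Over an algebraically closed field `k`, the characteristic polynomials of a finite algebra `T`
split into characters of `T`. The characters come from a full flag of ideals of `T`, which stays a
flag after extension of scalars; hence the same characters serve for every `k`-algebra `K`. -/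
theorem exists_elemCharpoly_eq_prod (n : ℕ) (hT : Module.finrank k T = n) :
    ∃ χ : Fin n → T →ₐ[k] k, ∀ (K : Type v) [CommRing K] [Algebra k K] (a : K ⊗[k] T),
      elemCharpoly K a = ∏ j, (Polynomial.X - Polynomial.C
        (Algebra.TensorProduct.lift (AlgHom.id K K) ((Algebra.ofId k K).comp (χ j))
          (fun _ _ => Commute.all _ _) a)) := by
  obtain ⟨b, χ, h⟩ := exists_basis_smul_sub_mem_span (k := k) (T := T) n T hT
  refine ⟨χ, fun K _ _ a => ?_⟩
  let c := Algebra.TensorProduct.basis K b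
  -- the matrix of multiplication by `a` is lower triangular with the stated diagonal entries
  have hrepr (t : T) (i j : Fin n) (hij : i ≤ j) :
      b.repr (t * b j) i = if i = j then χ j t else 0 := by
    have h0 : b.repr (t • b j - χ j t • b j) i = 0 := by
      by_contra hne
      have := b.repr_support_subset_of_mem_span _ (h t j) (Finsupp.mem_support_iff.2 hne)
      exact absurd hij (not_le.2 this)
    rw [map_sub, Finsupp.sub_apply, sub_eq_zero, smul_eq_mul] at h0
    rw [h0]
    simp [Finsupp.single_apply, eq_comm]
  have key (i j : Fin n) (hij : i ≤ j) : LinearMap.toMatrix c c (LinearMap.mulLeft K a) i j =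
      if i = j then Algebra.TensorProduct.lift (AlgHom.id K K) ((Algebra.ofId k K).comp (χ j))
          (fun _ _ => Commute.all _ _) a else 0 := by
    rw [LinearMap.toMatrix_apply, LinearMap.mulLeft_apply]
    induction a using TensorProduct.induction_on with
    | zero => simp
    | add x y hx hy => rw [add_mul, map_add, Finsupp.add_apply, hx, hy, map_add]; split_ifs <;> simp
    | tmul r t =>
      simp only [c, Algebra.TensorProduct.basis_apply, Algebra.TensorProduct.tmul_mul_tmul,
        Algebra.TensorProduct.basis_repr_tmul, Finsupp.smul_apply, Finsupp.mapRange_apply,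
        hrepr t i j hij]
      split_ifs <;> simp [Algebra.ofId_apply]
  rw [elemCharpoly, projCharpoly_eq_charpoly, ← LinearMap.charpoly_toMatrix _ c,
    ← Matrix.charpoly_transpose, Matrix.charpoly_of_isUpperTriangular]
  · refine Finset.prod_congr rfl fun j _ => ?_
    rw [Matrix.transpose_apply, key j j le_rfl, if_pos rfl]
  · intro i j hij
    have hij : j < i := hij
    rw [Matrix.transpose_apply, key j i hij.le, if_neg hij.ne]

end Flag

/-! ### Families of maps to fields -/

/-- Restricting the characters of `k ⊗ A` that split its characteristic polynomials to a subset
indexed by `S` gives a family with the divisibility property. -/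
theorem exists_charpolyDivisible_of_isAlgClosed {R : Type u} [CommRing R] {A : Type v} [CommRing A]
    [Algebra R A] [Module.Finite R A] [Module.Projective R A] {S : Type w} [Fintype S]
    (k : Type (max u v w)) [Field k] [IsAlgClosed k] [Algebra R k]
    (hS : Fintype.card S ≤ Module.finrank k (k ⊗[R] A)) :
    ∃ β : S → A →ₐ[R] k, CharpolyDivisible R β := by
  obtain ⟨χ, hχ⟩ := exists_elemCharpoly_eq_prod (k := k) (T := k ⊗[R] A) _ rfl
  obtain ⟨f⟩ : Nonempty (S ↪ Fin (Module.finrank k (k ⊗[R] A))) :=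
    Function.Embedding.nonempty_of_card_le (by simpa using hS)
  let β j : A →ₐ[R] k := ((χ j).restrictScalars R).comp Algebra.TensorProduct.includeRight
  refine ⟨fun s => β (f s), fun R' _ _ a => ?_⟩
  let _ : Algebra k (R' ⊗[R] k) := Algebra.TensorProduct.rightAlgebra
  let K := R' ⊗[R] k
  let e := Algebra.TensorProduct.cancelBaseChange R k K K A
  -- the characteristic polynomial of `a` over `K` is a product over all characters
  have hprod : (elemCharpoly R' a).map (algebraMap R' K) =
      ∏ j, (Polynomial.X - Polynomial.C (Algebra.TensorProduct.map (AlgHom.id R' R') (β j) a)) := by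
    rw [← elemCharpoly_map, ← elemCharpoly_algEquiv e.symm, hχ]
    refine Finset.prod_congr rfl fun j _ => ?_
    congr 2
    induction a using TensorProduct.induction_on with
    | zero => simp
    | add x y hx hy => simp only [map_add, hx, hy]
    | tmul r a =>
      simp [e, β, K, Algebra.ofId_apply, Algebra.TensorProduct.right_algebraMap_apply]
  change _ ∣ (elemCharpoly R' a).map (algebraMap R' K)
  rw [hprod, ← Finset.prod_map Finset.univ f fun j => (Polynomial.X - Polynomial.C
    (Algebra.TensorProduct.map (AlgHom.id R' R') (β j) a))]
  exact Finset.prod_dvd_prod_of_subset _ _ _ (Finset.subset_univ _)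

theorem exists_field_charpolyDivisible (R : Type u) [CommRing R] [Nontrivial R] (A : Type v)
    [CommRing A] [Algebra R A] [Module.Finite R A] [Module.Projective R A]
    (n : ℕ) (hrank : ∀ p : PrimeSpectrum R, Module.rankAtStalk (R := R) A p = n)
    (S : Type w) [Fintype S] (hS : Fintype.card S ≤ n) :
    ∃ (k : Type (max u v w)) (_ : Field k) (_ : Algebra R k) (β : S → A →ₐ[R] k),
      CharpolyDivisible R β := by
  obtain ⟨p⟩ : Nonempty (PrimeSpectrum R) := inferInstance
  -- lifting the residue field puts its algebraic closure in the universe that `IsSClosure` uses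
  let k := AlgebraicClosure (ULift.{max v w} p.asIdeal.ResidueField)
  refine ⟨k, inferInstance, inferInstance, exists_charpolyDivisible_of_isAlgClosed k ?_⟩
  have h := Module.rankAtStalk_baseChange (R := R) (M := A) (S := k) ⊥
  rw [hrank, Module.rankAtStalk_eq_finrank_of_free] at h
  exact hS.trans_eq (by simpa using h.symm)

/-! ### Generic elements and ideals of coordinates -/

section Generic

variable {R : Type*} [CommRing R]

/-- The ideal of `T` generated by the coordinates, with respect to the basis `b` of `P`, of the
elements of a subset of `P ⊗ T`. -/
noncomputable def coordIdeal {P T ι : Type*} [DecidableEq ι] [CommRing P] [Algebra R P]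
    [CommRing T] [Algebra R T] (b : Module.Basis ι R P) (X : Set (P ⊗[R] T)) : Ideal T :=
  Ideal.span {t | ∃ x ∈ X, ∃ i, TensorProduct.equivFinsuppOfBasisLeft b x i = t}

/-- The ideal of coordinates of `X` represents the vanishing of `X`: an algebra map kills the ideal
if and only if its base change to `P` kills `X`. -/
theorem coordIdeal_le_ker_iff {P T B ι : Type*} [DecidableEq ι] [CommRing P] [Algebra R P]
    [CommRing T] [Algebra R T] [CommRing B] [Algebra R B] (b : Module.Basis ι R P)
    (X : Set (P ⊗[R] T)) (ψ : T →ₐ[R] B) :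
    coordIdeal b X ≤ RingHom.ker ψ ↔
      ∀ x ∈ X, Algebra.TensorProduct.map (AlgHom.id P P) ψ x = 0 := by
  have key (x : P ⊗[R] T) (i : ι) : TensorProduct.equivFinsuppOfBasisLeft b
      (Algebra.TensorProduct.map (AlgHom.id P P) ψ x) i =
      ψ (TensorProduct.equivFinsuppOfBasisLeft b x i) := by
    induction x using TensorProduct.induction_on with
    | zero => simp
    | add x y hx hy => simp only [map_add, Finsupp.add_apply, hx, hy]
    | tmul r t => simp
  rw [coordIdeal, Ideal.span_le]
  constructor
  · intro h x hx
    refine (TensorProduct.equivFinsuppOfBasisLeft b).injective (Finsupp.ext fun i => ?_)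
    rw [key, map_zero]
    exact h ⟨x, hx, i, rfl⟩
  · rintro h _ ⟨x, hx, i, rfl⟩
    rw [SetLike.mem_coe, RingHom.mem_ker, ← key, h x hx]
    simp

variable {A : Type*} [CommRing A] [Algebra R A] {σ : Type*} [Fintype σ]

/-- The linear combination `∑ i, X i ⊗ g i` of the elements `g i` of `A` with indeterminate
coefficients. -/
noncomputable def genericElem (R : Type*) [CommRing R] {A : Type*} [CommRing A] [Algebra R A]
    {σ : Type*} [Fintype σ] (g : σ → A) : MvPolynomial σ R ⊗[R] A :=
  ∑ i, MvPolynomial.X i ⊗ₜ[R] g i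

/-- If the `g i` generate the module `A`, every element of a base change of `A` is a specialization
of the generic element. The `g i` need not be linearly independent, so `A` need not be free. -/
theorem exists_map_genericElem_eq (g : σ → A) (hg : Submodule.span R (Set.range g) = ⊤)
    {R' : Type*} [CommRing R'] [Algebra R R'] (a : R' ⊗[R] A) :
    ∃ θ : MvPolynomial σ R →ₐ[R] R',
      Algebra.TensorProduct.map θ (AlgHom.id R A) (genericElem R g) = a := by
  suffices ∃ r : σ → R', ∑ i, r i ⊗ₜ[R] g i = a by
    obtain ⟨r, hr⟩ := this
    exact ⟨MvPolynomial.aeval r, by simpa [genericElem] using hr⟩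
  induction a using TensorProduct.induction_on with
  | zero => exact ⟨0, by simp⟩
  | add x y hx hy =>
    obtain ⟨r, rfl⟩ := hx
    obtain ⟨s, rfl⟩ := hy
    exact ⟨r + s, by simp [TensorProduct.add_tmul, Finset.sum_add_distrib]⟩
  | tmul c a =>
    obtain ⟨d, rfl⟩ := (Submodule.mem_span_range_iff_exists_fun R).1
      (hg ▸ Submodule.mem_top : a ∈ Submodule.span R (Set.range g))
    exact ⟨fun i => d i • c, by simp [TensorProduct.tmul_sum, TensorProduct.smul_tmul]⟩

/-- The tensor power of `A` indexed by `S` is the coproduct of copies of `A`: existence of the map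
out of it. -/
theorem exists_algHom_comp_singleAlgHom_eq {S : Type*} [Fintype S] [DecidableEq S] {A B : Type*}
    [CommRing A] [Algebra R A] [CommRing B] [Algebra R B] (β : S → A →ₐ[R] B) :
    ∃ ψ : PiTensorProduct R (fun _ : S => A) →ₐ[R] B,
      ∀ s, ψ.comp (PiTensorProduct.singleAlgHom s) = β s := by
  refine ⟨PiTensorProduct.liftAlgHom
    ((MultilinearMap.mkPiAlgebra R S B).compLinearMap fun s => (β s).toLinearMap)
    (by simp) (by simp [Finset.prod_mul_distrib]), fun s => AlgHom.ext fun a => ?_⟩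
  refine (PiTensorProduct.lift.tprod _).trans ?_
  rw [MultilinearMap.compLinearMap_apply,
    MultilinearMap.mkPiAlgebra_apply, Finset.prod_eq_single s]
  · simp
  · intro t _ hts
    simp [hts]
  · simp

end Generic

/-! ### Existence of the closure -/

section Closure

variable {R : Type u} [CommRing R] {A : Type v} [CommRing A] [Algebra R A]
  [Module.Finite R A] [Module.Projective R A] {S : Type w} [Fintype S]

/-- The divisibility property, which ranges over all `R'` and `a`, amounts to one divisibility, that
for the generic element: both polynomials in the property are compatible with specialization. -/
theorem charpolyDivisible_iff_genericElem {σ : Type (max u v w)} [Fintype σ] (g : σ → A)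
    (hg : Submodule.span R (Set.range g) = ⊤) {B : Type (max u v w)} [CommRing B] [Algebra R B]
    (β : S → A →ₐ[R] B) :
    CharpolyDivisible R β ↔
      (∏ s : S, (Polynomial.X - Polynomial.C (Algebra.TensorProduct.map
        (AlgHom.id (MvPolynomial σ R) (MvPolynomial σ R)) (β s) (genericElem R g)))) ∣
      (elemCharpoly (MvPolynomial σ R) (genericElem R g)).map
        (algebraMap (MvPolynomial σ R) (MvPolynomial σ R ⊗[R] B)) := by
  refine ⟨fun h => h _ _, fun h R' _ _ a => ?_⟩
  obtain ⟨θ, rfl⟩ := exists_map_genericElem_eq g hg a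
  let _ : Algebra (MvPolynomial σ R) R' := θ.toRingHom.toAlgebra
  have : IsScalarTower R (MvPolynomial σ R) R' := .of_algHom θ
  have hθ : Algebra.TensorProduct.map θ (AlgHom.id R A) (genericElem R g) =
    Algebra.TensorProduct.map (Algebra.ofId (MvPolynomial σ R) R') (AlgHom.id R A)
      (genericElem R g) := rfl
  have := map_dvd (Polynomial.mapRingHom
    (Algebra.TensorProduct.map θ (AlgHom.id R B)).toRingHom) h
  rw [map_prod] at this
  convert this using 1
  · refine Finset.prod_congr rfl fun s _ => ?_
    rw [Polynomial.coe_mapRingHom, Polynomial.map_sub, Polynomial.map_X, Polynomial.map_C]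
    congr 2
    generalize genericElem R g = x
    induction x using TensorProduct.induction_on with
    | zero => simp
    | add x y hx hy => simp only [map_add, hx, hy]
    | tmul r a => simp
  · rw [hθ, elemCharpoly_map, Polynomial.coe_mapRingHom, Polynomial.map_map, Polynomial.map_map]
    congr 1

theorem exists_isSClosure (R : Type u) [CommRing R] (A : Type v) [CommRing A] [Algebra R A]
    [Module.Finite R A] [Module.Projective R A] (S : Type w) [Fintype S] :
    ∃ (C : Type (max u v w)) (_ : CommRing C) (_ : Algebra R C) (α : S → A →ₐ[R] C),
      IsSClosure R C α := by
  classical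
  obtain ⟨m, g₀, hg₀⟩ := Module.Finite.exists_fin (R := R) (M := A)
  let σ := ULift.{max u v w} (Fin m)
  let g : σ → A := g₀ ∘ ULift.down
  have hg : Submodule.span R (Set.range g) = ⊤ := by
    rw [Set.range_comp, ULift.down_surjective.range_eq, Set.image_univ, hg₀]
  let P := MvPolynomial σ R
  -- `p` and `q` are the two sides of the divisibility property for the generic element, and `T`
  -- with the maps `ι s` is universal among the algebras with a family of maps from `A`
  let T := PiTensorProduct R fun _ : S => A
  let ι : S → A →ₐ[R] T := PiTensorProduct.singleAlgHom
  let p {B : Type (max u v w)} [CommRing B] [Algebra R B] (β : S → A →ₐ[R] B) : (P ⊗[R] B)[X] :=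
    ∏ s : S, (Polynomial.X - Polynomial.C (Algebra.TensorProduct.map
      (AlgHom.id P P) (β s) (genericElem R g)))
  let q (B : Type (max u v w)) [CommRing B] [Algebra R B] : (P ⊗[R] B)[X] :=
    (elemCharpoly P (genericElem R g)).map (algebraMap P (P ⊗[R] B))
  have hp {B : Type (max u v w)} [CommRing B] [Algebra R B] (β : S → A →ₐ[R] B) : (p β).Monic :=
    Polynomial.monic_prod_of_monic _ _ fun s _ => Polynomial.monic_X_sub_C _
  let X : Set (P ⊗[R] T) := Set.range (q T %ₘ p ι).coeff
  let b := MvPolynomial.basisMonomials σ R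
  let I : Ideal T := coordIdeal b X
  -- a family of maps has the divisibility property if and only if the map from `T` kills `I`
  have hI (B : Type (max u v w)) [CommRing B] [Algebra R B] (ψ : T →ₐ[R] B) :
      I ≤ RingHom.ker ψ ↔ CharpolyDivisible R fun s => ψ.comp (ι s) := by
    let Ψ := Algebra.TensorProduct.map (AlgHom.id P P) ψ
    have h1 : (p ι).map Ψ.toRingHom = p fun s => ψ.comp (ι s) := by
      rw [Polynomial.map_prod]
      refine Finset.prod_congr rfl fun s _ => ?_
      rw [Polynomial.map_sub, Polynomial.map_X, Polynomial.map_C]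
      congr 2
      generalize genericElem R g = x
      induction x using TensorProduct.induction_on with
      | zero => simp
      | add x y hx hy => simp only [map_add, hx, hy]
      | tmul r a => simp [Ψ]
    have h2 : (q T).map Ψ.toRingHom = q B := by
      rw [Polynomial.map_map]
      congr 1
      exact Ψ.comp_algebraMap
    rw [charpolyDivisible_iff_genericElem g hg, ← Polynomial.modByMonic_eq_zero_iff_dvd (hp _)]
    change _ ↔ q B %ₘ p _ = 0
    rw [← h1, ← h2, ← Polynomial.map_modByMonic _ (hp _), coordIdeal_le_ker_iff, Polynomial.ext_iff]
    simp [X, Ψ, P]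
  refine ⟨T ⧸ I, inferInstance, inferInstance, fun s => (Ideal.Quotient.mkₐ R I).comp (ι s),
    (hI _ _).1 (Ideal.Quotient.mkₐ_ker R I).ge, fun B _ _ β hβ => ?_⟩
  obtain ⟨ψ, hψ⟩ := exists_algHom_comp_singleAlgHom_eq β
  have hψ : (fun s => ψ.comp (ι s)) = β := funext hψ
  have hker := (hI B ψ).2 (hψ ▸ hβ)
  refine ⟨Ideal.Quotient.liftₐ I ψ fun t ht => hker ht, fun s => ?_, fun φ hφ => ?_⟩
  · rw [← hψ]
    exact AlgHom.ext fun a => rfl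
  · refine Ideal.Quotient.algHom_ext _ (PiTensorProduct.algHom_ext fun s => ?_)
    have := hφ s
    rw [← hψ] at this
    exact AlgHom.ext fun a => DFunLike.congr_fun this a

end Closure

/-! ### The closure is not the zero ring -/

theorem mainTheorem4 (R : Type u) [CommRing R] [Nontrivial R]
    (A : Type v) [CommRing A] [Algebra R A] [Module.Finite R A] [Module.Projective R A]
    (n : ℕ) (hn : 0 < n) (hrank : ∀ p : PrimeSpectrum R, Module.rankAtStalk (R := R) A p = n)
    (S : Type w) [Fintype S] (hS : Fintype.card S ≤ n) :
    (∃ (C : Type (max u v w)) (_ : CommRing C) (_ : Algebra R C) (α : S → A →ₐ[R] C),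
      IsSClosure R C α) ∧
    ∀ (C : Type (max u v w)) [CommRing C] [Algebra R C] (α : S → A →ₐ[R] C),
      IsSClosure R C α → Nontrivial C := by
  refine ⟨exists_isSClosure R A S, fun C _ _ α hC => ?_⟩
  obtain ⟨k, _, _, β, hβ⟩ := exists_field_charpolyDivisible R A n hrank S hS
  obtain ⟨φ, -, -⟩ := hC.universal k β hβ
  exact φ.toRingHom.domain_nontrivial
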